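/- Let $n \ge 5$, let $S_n$ and $T_n$ be the symmetric group and the full transformation monoid on $\{1,\dots,n\}$, with maps acting on the right (so $fg$ means first $f$, then $g$), and let $\langle A \mid R\rangle$ be any monoid presentation for $S_n$. Let $\zeta \notin A$. Then $T_n$ is defined by the monoid presentation with generators $A \cup \{\zeta\}$ and relations $R$ together with the following five relations: \begin{align*} &\zeta(1,3)\zeta(1,3) = \zeta;\\ &(3,4)\zeta = \zeta(3,4);\\ &(1,n)(2,3)\zeta(1,n)(2,3)\zeta = \zeta(1,n)(2,3)\zeta(1,n)(2,3);\\ &(2,3)\zeta(2,3)\zeta(2,3)\zeta(2,3) = \zeta(2,3)\zeta;\\ &(3,4,\dots,n)(1,2)\zeta = \zeta(3,4,\dots,n). \end{align*} Here the permutations written in disjoint cycle notation denote any words over $A$ representing these permutations, the elements of $A$ represent the same permutations in $T_n$ as in $S_n$, and $\zeta$ represents the idempotent of rank $n-1$ that maps $2$ to $1$ and fixes every other point. -/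

import Mathlib

/-- The symmetric group `S_n`, acting on the right: `σ * τ` means first `σ`, then `τ`. -/
abbrev SymGroup (n : ℕ) : Type := (Equiv.Perm (Fin n))ᵐᵒᵖ

/-- The full transformation monoid `T_n`, acting on the right: `f * g` means first `f`,
then `g`. -/
abbrev TransMonoid (n : ℕ) : Type := (Function.End (Fin n))ᵐᵒᵖ

/-- The inclusion of `S_n` in `T_n`. -/
def permToTrans {n : ℕ} (σ : SymGroup n) : TransMonoid n :=
  MulOpposite.op (fun x => σ.unop x)

/-- The point `i` of `{1, …, n}`, which is modelled by `Fin n`, so that `i` has index `i - 1`. -/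
def pt {n : ℕ} (i : ℕ) (h : 1 ≤ i ∧ i ≤ n) : Fin n := ⟨i - 1, by omega⟩

/-- The transposition `(i, j)`. -/
def transp {n : ℕ} (i j : ℕ) (hi : 1 ≤ i ∧ i ≤ n) (hj : 1 ≤ j ∧ j ≤ n) : SymGroup n :=
  MulOpposite.op (Equiv.swap (pt i hi) (pt j hj))

/-- The cycle `(3, 4, …, n)`: the list of all points in increasing order with `1` and `2`
removed, read as a cycle. -/
def longCycle (n : ℕ) : SymGroup n :=
  MulOpposite.op ((List.finRange n).drop 2).formPerm

/-- The idempotent of `T_n` of rank `n - 1` that maps `2` to `1` and fixes all other points. -/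
def idem (n : ℕ) (hn : 5 ≤ n) : TransMonoid n :=
  MulOpposite.op (fun x => if x = pt 2 (by omega) then pt 1 (by omega) else x)

/-- Words over `A`, regarded as words over `A ∪ {ζ}`; here `A ∪ {ζ}` is `Option A`. -/
def liftWord {A : Type*} : FreeMonoid A →* FreeMonoid (Option A) :=
  FreeMonoid.map some

/-- The new generator `ζ`, as a word over `A ∪ {ζ}`. -/
def zeta {A : Type*} : FreeMonoid (Option A) := FreeMonoid.of none

/-- The relations over `A ∪ {ζ}`: those of `R`, and five more. The words `p i`, `q i`, `r i`,
`s i`, `t`, `u` stand for the occurrences, in order, of the permutations `(1, 3)`, `(3, 4)`,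
`(1, n)(2, 3)`, `(2, 3)`, `(3, 4, …, n)(1, 2)` and `(3, 4, …, n)`. -/
inductive TransRels {A : Type*} (R : FreeMonoid A → FreeMonoid A → Prop)
    (p q : Fin 2 → FreeMonoid A) (r : Fin 4 → FreeMonoid A) (s : Fin 5 → FreeMonoid A)
    (t u : FreeMonoid A) : FreeMonoid (Option A) → FreeMonoid (Option A) → Prop
  | ofBase {v w : FreeMonoid A} (h : R v w) :
      TransRels R p q r s t u (liftWord v) (liftWord w)
  | rel1 : TransRels R p q r s t u
      (zeta * liftWord (p 0) * zeta * liftWord (p 1))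
      zeta
  | rel3 : TransRels R p q r s t u
      (liftWord (q 0) * zeta)
      (zeta * liftWord (q 1))
  | rel7 : TransRels R p q r s t u
      (liftWord (r 0) * zeta * liftWord (r 1) * zeta)
      (zeta * liftWord (r 2) * zeta * liftWord (r 3))
  | rel8 : TransRels R p q r s t u
      (liftWord (s 0) * zeta * liftWord (s 1) * zeta * liftWord (s 2) * zeta * liftWord (s 3))
      (zeta * liftWord (s 4) * zeta)
  | rel9 : TransRels R p q r s t u
      (liftWord t * zeta)
      (zeta * liftWord u)

/-! A map factors as a retraction `r`, which sends each point to a chosen representative of its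
kernel class, followed by a permutation. The proof lifts this factorisation to the presented monoid.

The elements `e i j` are the conjugates of `ζ` by permutations. They are well defined because `ζ`
commutes with every permutation fixing 1 and 2 (`commute_of_fixes`), and 4-transitivity spreads each
given relation to all tuples of distinct points (`CollapseSystem.ofGenerator`).

The factors `e (r k) k` commute, so they have a product `retractProd r`. The elements `retractProd r
* p σ` exhaust the monoid, since right multiplication by `e i j` preserves this form
(`exists_retractProd_mul_e`). The form is not unique: representatives may change, and `σ` is free
off the image of `r`. But any two forms of the same map are equal in the monoid
(`retractProd_mul_p_congr`), which gives injectivity; surjectivity is the factorisation itself. -/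

open Equiv in
/-- Images `p σ` of the permutations and elements `e i j` of a monoid that satisfy the basic
relations of the idempotents of defect one; `e i j` stands for the map that sends `j` to `i` and
fixes all other points, and maps act on the right. -/
structure CollapseSystem (α M : Type*) [DecidableEq α] [Monoid M] where
  p : Perm α → M
  e : α → α → M
  p_one : p 1 = 1
  p_mul_p : ∀ σ τ, p σ * p τ = p (τ * σ)
  e_mul_p : ∀ {i j} (σ : Perm α), i ≠ j → e i j * p σ = p σ * e (σ i) (σ j)
  swap_mul_e : ∀ {i j}, i ≠ j → p (swap i j) * e i j = e i j
  e_mul_e_of_ne : ∀ {i j k}, i ≠ j → k ≠ j → i ≠ k → e i j * e k j = e i j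
  e_comm_of_disjoint : ∀ {i j k l}, i ≠ j → i ≠ k → i ≠ l → j ≠ k → j ≠ l → k ≠ l →
    e i j * e k l = e k l * e i j
  e_mul_e_mul_e : ∀ {i j k}, i ≠ j → i ≠ k → j ≠ k →
    e i k * e i j * e i k = e i j * p (swap j k) * e i j
  exists_third : ∀ i j : α, ∃ k, k ≠ i ∧ k ≠ j

namespace Finset

/-- A factor that intertwines two families moves across their products. -/
lemma noncommProd_mul_eq_mul_noncommProd {ι M : Type*} [DecidableEq ι] [Monoid M] (s : Finset ι)
    {f g : ι → M} (hf : (s : Set ι).Pairwise (Function.onFun Commute f))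
    (hg : (s : Set ι).Pairwise (Function.onFun Commute g)) (x : M)
    (h : ∀ k ∈ s, f k * x = x * g k) :
    s.noncommProd f hf * x = x * s.noncommProd g hg := by
  induction s using Finset.induction_on with
  | empty => simp
  | insert a s ha ih =>
    rw [noncommProd_insert_of_notMem _ _ _ _ ha, noncommProd_insert_of_notMem _ _ _ _ ha,
      mul_assoc, ih _ _ fun k hk => h k (mem_insert_of_mem hk), ← mul_assoc,
      h a (mem_insert_self a s), mul_assoc]

end Finset

/-! ### Consequences of the basic relations for products of two or three collapses. -/

namespace CollapseSystem

open Equiv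

variable {α M : Type*} [DecidableEq α] [Monoid M] (S : CollapseSystem α M) {i j k l m : α}

lemma swap_mul_swap_cancel (i j : α) : S.p (swap i j) * S.p (swap i j) = 1 := by
  rw [S.p_mul_p, swap_mul_self, S.p_one]

lemma eq_of_mul_swap_eq {x y : M} (i j : α) (h : x * S.p (swap i j) = y * S.p (swap i j)) :
    x = y := by
  simpa [mul_assoc, S.swap_mul_swap_cancel] using congrArg (· * S.p (swap i j)) h

lemma e_mul_swap (h : i ≠ j) : S.e i j * S.p (swap i j) = S.e j i := by
  rw [S.e_mul_p _ h, swap_apply_left, swap_apply_right, swap_comm, S.swap_mul_e h.symm]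

lemma e_mul_self (h : i ≠ j) : S.e i j * S.e i j = S.e i j := by
  obtain ⟨k, hki, hkj⟩ := S.exists_third i j
  have h1 := S.e_mul_e_of_ne h hkj hki.symm
  have h2 := S.e_mul_e_of_ne hkj h hki
  calc S.e i j * S.e i j = S.e i j * (S.e k j * S.e i j) := by rw [← mul_assoc, h1]
    _ = S.e i j := by rw [h2, h1]

lemma e_mul_e_same_right (hi : i ≠ j) (hk : k ≠ j) : S.e i j * S.e k j = S.e i j := by
  rcases eq_or_ne i k with rfl | h
  · exact S.e_mul_self hi
  · exact S.e_mul_e_of_ne hi hk h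

/-- Once `i` has left the image, collapsing `j` to `i` has the same effect as exchanging them. -/
lemma e_mul_e_chain (hm : m ≠ i) (hij : i ≠ j) :
    S.e m i * S.e i j = S.e m i * S.p (swap i j) := by
  rw [← S.e_mul_swap hij.symm, ← mul_assoc, S.e_mul_e_same_right hm hij.symm, swap_comm]

lemma swap_mul_e_of_ne (hij : i ≠ j) (hik : i ≠ k) :
    S.p (swap j k) * S.e i j = S.e i k * S.p (swap j k) := by
  rw [S.e_mul_p _ hik, swap_apply_of_ne_of_ne hij hik, swap_apply_right]

lemma e_mul_e_mul_e_eq (hij : i ≠ j) (hik : i ≠ k) (hjk : j ≠ k) :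
    S.e i k * S.e i j * S.e i k = S.e i j * S.e i k * S.p (swap j k) := by
  rw [S.e_mul_e_mul_e hij hik hjk, mul_assoc, S.swap_mul_e_of_ne hij hik, mul_assoc]

/-- With `X = e i j`, `Y = e i k` and `π` the swap, the triple relation reads `Y X Y = X Y π`. Its
left side absorbs `Y` on the right, while `π Y = X π`; hence `X Y X π = X Y π`, and `π` cancels. -/
lemma e_mul_e_mul_left (hij : i ≠ j) (hik : i ≠ k) (hjk : j ≠ k) :
    S.e i j * S.e i k * S.e i j = S.e i j * S.e i k := by
  have h := S.e_mul_e_mul_e_eq hij hik hjk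
  have h1 : S.e i j * S.e i k * S.p (swap j k) * S.e i k
      = S.e i j * S.e i k * S.p (swap j k) := by
    rw [← h, mul_assoc _ (S.e i k), S.e_mul_self hik]
  apply S.eq_of_mul_swap_eq j k
  rw [← h1, mul_assoc _ (S.e i j), mul_assoc _ (S.p _), swap_comm, S.swap_mul_e_of_ne hik hij]

lemma e_mul_e_mul_swap_same (hij : i ≠ j) (hik : i ≠ k) (hjk : j ≠ k) :
    S.e i j * S.e i k * S.p (swap j k) = S.e i j * S.e i k := by
  have h := congrArg (S.e i j * ·) (S.e_mul_e_mul_e_eq hij hik hjk)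
  simp only [← mul_assoc, S.e_mul_self hij, S.e_mul_e_mul_left hij hik hjk] at h
  rw [← h, mul_assoc, S.e_mul_self hik]

/-- In the triple relation `Y X Y = X Y π` the right side reduces to `X Y` and the left side to `Y
X`. -/
lemma e_comm_same (hij : i ≠ j) (hik : i ≠ k) : S.e i j * S.e i k = S.e i k * S.e i j := by
  rcases eq_or_ne j k with rfl | hjk
  · rfl
  rw [← S.e_mul_e_mul_left hik hij hjk.symm, S.e_mul_e_mul_e_eq hij hik hjk,
    S.e_mul_e_mul_swap_same hij hik hjk]

lemma e_mul_e_move (hij : i ≠ j) (hik : i ≠ k) (hjk : j ≠ k) :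
    S.e j k * S.e i j = S.e i j * S.e i k := by
  rw [← S.swap_mul_e hij, ← mul_assoc, S.e_mul_p _ hjk, swap_apply_right,
    swap_apply_of_ne_of_ne hik.symm hjk.symm, mul_assoc, S.e_comm_same hik hij, ← mul_assoc]

lemma e_comm (hij : i ≠ j) (hil : i ≠ l) (hkj : k ≠ j) (hkl : k ≠ l) (hjl : j ≠ l) :
    S.e i j * S.e k l = S.e k l * S.e i j := by
  rcases eq_or_ne i k with rfl | hik
  · exact S.e_comm_same hij hil
  · exact S.e_comm_of_disjoint hij hik hil hkj.symm hjl hkl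

/-- Neither `j` nor `l` is in the image, so exchanging them changes nothing. For `i ≠ k` the swap is
traded for `e j l`, which is then absorbed by `e k l`. -/
lemma e_mul_e_mul_swap (hij : i ≠ j) (hil : i ≠ l) (hkj : k ≠ j) (hkl : k ≠ l) (hjl : j ≠ l) :
    S.e i j * S.e k l * S.p (swap j l) = S.e i j * S.e k l := by
  rcases eq_or_ne i k with rfl | hik
  · exact S.e_mul_e_mul_swap_same hij hil hjl
  · rw [S.e_comm hij hil hkj hkl hjl, mul_assoc, ← S.e_mul_e_chain hij hjl, ← mul_assoc,
      ← S.e_comm hij hil hkj hkl hjl, mul_assoc, S.e_mul_e_same_right hkl hjl]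

/-! ### Products of commuting collapses attached to a retraction. -/

/-- The factor of `S.retractProd r` that collapses `k` to `r k`. -/
def retractFactor (r : α → α) (k : α) : M := if r k = k then 1 else S.e (r k) k

lemma retractFactor_of_fixed {r : α → α} (h : r k = k) : S.retractFactor r k = 1 := if_pos h

lemma retractFactor_eq {r : α → α} (h : r k = m) (hm : m ≠ k) :
    S.retractFactor r k = S.e m k := by
  rw [retractFactor, h, if_neg hm]

lemma retractFactor_of_ne {r : α → α} (h : r k ≠ k) : S.retractFactor r k = S.e (r k) k :=
  if_neg h

lemma commute_retractFactor {r : α → α} (hr : ∀ x, r (r x) = r x) (s : Set α) :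
    s.Pairwise (Function.onFun Commute (S.retractFactor r)) := by
  intro k _ l _ hkl
  change S.retractFactor r k * S.retractFactor r l = S.retractFactor r l * S.retractFactor r k
  by_cases hk : r k = k
  · rw [S.retractFactor_of_fixed hk, one_mul, mul_one]
  by_cases hl : r l = l
  · rw [S.retractFactor_of_fixed hl, one_mul, mul_one]
  rw [S.retractFactor_of_ne hk, S.retractFactor_of_ne hl]
  exact S.e_comm hk (fun h => hl (by rw [← h, hr])) (fun h => hk (by rw [← h, hr])) hl hkl

lemma noncommProd_retractFactor_erase {r : α → α} (hr : ∀ x, r (r x) = r x) (s : Finset α)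
    (hk : r k = k) :
    s.noncommProd (S.retractFactor r) (S.commute_retractFactor hr _) =
      (s.erase k).noncommProd (S.retractFactor r) (S.commute_retractFactor hr _) := by
  by_cases hks : k ∈ s
  · rw [← Finset.mul_noncommProd_erase s hks _ (S.commute_retractFactor hr _),
      S.retractFactor_of_fixed hk, one_mul]
  · simp only [Finset.erase_eq_of_notMem hks]

/-- The map `r` with all points sent to `j` now sent to `i`. -/
def redirect (r : α → α) (j i : α) (x : α) : α := if r x = j then i else r x

lemma redirect_idem {r : α → α} (hr : ∀ x, r (r x) = r x) (hi : r i = i ∨ r i = j) (x : α) :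
    redirect r j i (redirect r j i x) = redirect r j i x := by
  unfold redirect
  by_cases hx : r x = j
  · rw [if_pos hx]
    split_ifs with h
    · rfl
    · exact hi.resolve_right h
  · rw [if_neg hx, hr, if_neg hx]

variable [Fintype α]

/-- The product that represents a retraction `r`: the product of all `e (r k) k` with
`r k ≠ k`. -/
def retractProd (r : α → α) (hr : ∀ x, r (r x) = r x) : M :=
  Finset.univ.noncommProd (S.retractFactor r) (S.commute_retractFactor hr _)

lemma retractProd_id : S.retractProd id (fun _ => rfl) = 1 :=
  Finset.noncommProd_eq_pow_card _ _ _ 1 (fun _ _ => S.retractFactor_of_fixed rfl) |>.trans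
    (one_pow _)

variable {r : α → α}

lemma retractProd_eq_mul (hr : ∀ x, r (r x) = r x) (k : α) :
    S.retractProd r hr = S.retractFactor r k *
      (Finset.univ.erase k).noncommProd (S.retractFactor r) (S.commute_retractFactor hr _) :=
  (Finset.mul_noncommProd_erase _ (Finset.mem_univ k) _ _).symm

lemma retractProd_eq_mul' (hr : ∀ x, r (r x) = r x) (k : α) :
    S.retractProd r hr =
      (Finset.univ.erase k).noncommProd (S.retractFactor r) (S.commute_retractFactor hr _) *
        S.retractFactor r k :=
  (Finset.noncommProd_erase_mul _ (Finset.mem_univ k) _ _).symm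

lemma retractProd_mul_e_of_moved (hr : ∀ x, r (r x) = r x) (hij : i ≠ j) (hj : r j ≠ j) :
    S.retractProd r hr * S.e i j = S.retractProd r hr := by
  rw [S.retractProd_eq_mul' hr j, S.retractFactor_of_ne hj, mul_assoc,
    S.e_mul_e_same_right hj hij]

lemma retractProd_mul_e_of_source_moved (hr : ∀ x, r (r x) = r x) (hij : i ≠ j) (hi : r i ≠ i) :
    S.retractProd r hr * S.e i j = S.retractProd r hr * S.p (swap i j) := by
  rw [S.retractProd_eq_mul' hr i, S.retractFactor_of_ne hi, mul_assoc, S.e_mul_e_chain hi hij,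
    ← mul_assoc]

/-- The new collapse becomes the factor at `j`. Pulled to the front, it turns each factor `e j k`
into `e i k` and commutes with all others. -/
lemma retractProd_mul_e_of_fixed (hr : ∀ x, r (r x) = r x) (hij : i ≠ j) (hi : r i = i)
    (hj : r j = j) :
    S.retractProd r hr * S.e i j =
      S.retractProd (redirect r j i) (redirect_idem hr (Or.inl hi)) := by
  have hj' : redirect r j i j = i := if_pos hj
  rw [S.retractProd_eq_mul hr j, S.retractFactor_of_fixed hj, one_mul,
    S.retractProd_eq_mul (redirect_idem hr (Or.inl hi)) j,
    S.retractFactor_eq hj' hij]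
  apply Finset.noncommProd_mul_eq_mul_noncommProd
  intro k hk
  have hkj : k ≠ j := Finset.ne_of_mem_erase hk
  by_cases hk1 : r k = k
  · rw [S.retractFactor_of_fixed hk1, S.retractFactor_of_fixed, one_mul, mul_one]
    rw [redirect, hk1, if_neg hkj]
  have hki : k ≠ i := fun h => hk1 (h ▸ hi)
  by_cases hk2 : r k = j
  · have h : redirect r j i k = i := if_pos hk2
    rw [S.retractFactor_eq hk2 hkj.symm, S.retractFactor_eq h hki.symm,
      S.e_mul_e_move hij hki.symm hkj.symm]
  · have h : redirect r j i k = r k := if_neg hk2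
    rw [S.retractFactor_of_ne hk1, S.retractFactor_eq h hk1,
      S.e_comm hk1 hk2 hki.symm hij hkj]

lemma retractProd_mul_swap_of_moved (hr : ∀ x, r (r x) = r x) (hi : r i ≠ i) (hj : r j ≠ j) :
    S.retractProd r hr * S.p (swap i j) = S.retractProd r hr := by
  rcases eq_or_ne i j with rfl | hij
  · rw [swap_self]
    exact (congrArg _ S.p_one).trans (mul_one _)
  rw [S.retractProd_eq_mul' hr j, ← Finset.noncommProd_erase_mul (Finset.univ.erase j)
    (Finset.mem_erase.2 ⟨hij, Finset.mem_univ i⟩) _ (S.commute_retractFactor hr _),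
    S.retractFactor_of_ne hi, S.retractFactor_of_ne hj, mul_assoc, mul_assoc,
    ← mul_assoc (S.e _ _),
    S.e_mul_e_mul_swap hi (fun h => hj (by rw [← h, hr])) (fun h => hi (by rw [← h, hr])) hj hij,
    mul_assoc]

/-- Multiplication by a transposition changes the representative of a class. -/
lemma retractProd_mul_swap_of_fixed (hr : ∀ x, r (r x) = r x) (hij : i ≠ j) (hi : r i = j) :
    S.retractProd r hr * S.p (swap i j) =
      S.retractProd (redirect r j i) (redirect_idem hr (Or.inr hi)) := by
  have hj : r j = j := by rw [← hi, hr]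
  have hj' : redirect r j i j = i := if_pos hj
  have hi' : redirect r j i i = i := if_pos hi
  -- `r` fixes `j` and the redirected map fixes `i`; dropping these trivial factors leaves both
  -- products over the complement of `{i, j}`. The swap turns the split-off factor `e j i` into `e i
  -- j`.
  rw [S.retractProd_eq_mul hr i, S.noncommProd_retractFactor_erase hr _ hj,
    S.retractFactor_eq hi hij.symm,
    S.retractProd_eq_mul (redirect_idem hr (Or.inr hi)) j,
    S.noncommProd_retractFactor_erase (redirect_idem hr (Or.inr hi)) _ hi',
    S.retractFactor_eq hj' hij, mul_assoc,
    Finset.noncommProd_mul_eq_mul_noncommProd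
      (g := S.retractFactor (redirect r j i))
      (hg := S.commute_retractFactor (redirect_idem hr (Or.inr hi)) _),
    ← mul_assoc, swap_comm, S.e_mul_swap hij.symm]
  · simp only [Finset.erase_right_comm (a := i)]
  intro k hk
  have hkj : k ≠ j := Finset.ne_of_mem_erase hk
  have hki : k ≠ i := Finset.ne_of_mem_erase (Finset.mem_of_mem_erase hk)
  by_cases hk1 : r k = k
  · rw [S.retractFactor_of_fixed hk1, S.retractFactor_of_fixed, one_mul, mul_one]
    rw [redirect, hk1, if_neg hkj]
  by_cases hk2 : r k = j
  · have h : redirect r j i k = i := if_pos hk2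
    rw [S.retractFactor_eq hk2 hkj.symm, S.retractFactor_eq h hki.symm,
      S.e_mul_p _ hkj.symm, swap_apply_right, swap_apply_of_ne_of_ne hki hkj]
  · have h : redirect r j i k = r k := if_neg hk2
    rw [S.retractFactor_of_ne hk1, S.retractFactor_eq h hk1,
      S.e_mul_p _ hk1, swap_apply_of_ne_of_ne _ hk2, swap_apply_of_ne_of_ne hki hkj]
    intro hki'
    exact hk2 (by rw [← hr, hki', hi])

/-- Products that represent the same map are equal. -/
lemma retractProd_mul_p_eq (τ : Perm α) {r r' : α → α} (hr : ∀ x, r (r x) = r x)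
    (hr' : ∀ x, r' (r' x) = r' x) (h : ∀ x, r' x = τ (r x)) :
    S.retractProd r hr * S.p τ = S.retractProd r' hr' := by
  induction hn : τ.support.card using Nat.strong_induction_on generalizing τ r r' with
  | _ n ih =>
    have key : ∀ x, τ x ≠ x → ∀ {s : α → α} (hs : ∀ y, s (s y) = s y),
        S.retractProd r hr * S.p (swap x (τ x)) = S.retractProd s hs →
        (∀ y, s y = swap x (τ x) (r y)) →
        S.retractProd r hr * S.p τ = S.retractProd r' hr' := by
      intro x hx s hs h1 h2
      -- The swap of `x` and `τ x` has to act before the rest of `τ`; the remaining permutation has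
      -- smaller support.
      have hτ : τ = swap (τ x) (τ (τ x)) * τ * swap x (τ x) := by
        rw [mul_assoc, mul_swap_eq_swap_mul, ← mul_assoc, swap_mul_self, one_mul]
      rw [hτ, ← S.p_mul_p, ← mul_assoc, h1]
      refine ih _ ?_ _ hs hr' ?_ rfl
      · rw [← hn]
        exact Perm.card_support_swap_mul (fun h => hx (τ.injective h))
      · intro y
        rw [h, h2]
        exact DFunLike.congr_fun hτ (r y)
    by_cases hA : ∃ x, r x = x ∧ τ x ≠ x
    · obtain ⟨x, hx, hτx⟩ := hA
      have h1 : r' x = τ x := by rw [h, hx]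
      have h2 : r (τ x) = x := τ.injective (by rw [← h, ← h1, hr'])
      refine key x hτx (redirect_idem hr (Or.inr h2)) ?_ ?_
      · rw [swap_comm]
        exact S.retractProd_mul_swap_of_fixed hr hτx h2
      · intro y
        by_cases hy : r y = x
        · rw [redirect, if_pos hy, hy, swap_apply_left]
        · rw [redirect, if_neg hy, swap_apply_of_ne_of_ne hy]
          intro hy'
          exact hy (by rw [← hr, hy', h2])
    -- Now `τ` fixes the image of `r` pointwise, so a moved `x` and its image `τ x` both lie outside
    -- it and their swap is absorbed.
    · push Not at hA
      by_cases hτ : τ = 1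
      · subst hτ
        obtain rfl : r' = r := funext h
        rw [S.p_one, mul_one]
      obtain ⟨x, hx⟩ : ∃ x, τ x ≠ x := by
        by_contra! hc
        exact hτ (Perm.ext hc)
      have hx1 : r x ≠ x := fun h => hx (hA x h)
      have hx2 : r (τ x) ≠ τ x := fun h => hx (τ.injective (hA _ h))
      refine key x hx hr (S.retractProd_mul_swap_of_moved hr hx1 hx2) fun y => ?_
      rw [swap_apply_of_ne_of_ne]
      · exact fun h => hx1 (by rw [← h, hr])
      · exact fun h => hx2 (by rw [← h, hr])

/-- The elements of the form `S.retractProd r hr * S.p σ` are closed under multiplication by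
the elements `e i j` on the right. -/
lemma exists_retractProd_mul_e (hij : i ≠ j) (hr : ∀ x, r (r x) = r x) (σ : Perm α) :
    ∃ (r' : α → α) (hr' : ∀ x, r' (r' x) = r' x) (τ : Perm α),
      S.retractProd r hr * S.p σ * S.e i j = S.retractProd r' hr' * S.p τ := by
  have hij' : σ⁻¹ i ≠ σ⁻¹ j := fun h => hij (σ⁻¹.injective h)
  have h : S.p σ * S.e i j = S.e (σ⁻¹ i) (σ⁻¹ j) * S.p σ := by
    rw [S.e_mul_p _ hij', show σ (σ⁻¹ i) = i by simp, show σ (σ⁻¹ j) = j by simp]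
  rw [mul_assoc, h, ← mul_assoc]
  by_cases hj : r (σ⁻¹ j) = σ⁻¹ j
  · by_cases hi : r (σ⁻¹ i) = σ⁻¹ i
    · exact ⟨_, _, σ, by rw [S.retractProd_mul_e_of_fixed hr hij' hi hj]⟩
    · exact ⟨r, hr, σ * swap (σ⁻¹ i) (σ⁻¹ j), by
        rw [S.retractProd_mul_e_of_source_moved hr hij' hi, mul_assoc, S.p_mul_p]⟩
  · exact ⟨r, hr, σ, by rw [S.retractProd_mul_e_of_moved hr hij' hj]⟩

/-- Two elements in normal form that represent the same map are equal. -/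
lemma retractProd_mul_p_congr {r r' : α → α} (hr : ∀ x, r (r x) = r x)
    (hr' : ∀ x, r' (r' x) = r' x) {σ σ' : Perm α} (h : ∀ x, σ (r x) = σ' (r' x)) :
    S.retractProd r hr * S.p σ = S.retractProd r' hr' * S.p σ' := by
  rw [← S.retractProd_mul_p_eq (σ'⁻¹ * σ) hr hr' fun x => by
    simp [h], mul_assoc, S.p_mul_p, mul_inv_cancel_left]

/-- The image of `S.retractProd r hr` in the full transformation monoid. -/
lemma map_retractProd (F : M →* (Function.End α)ᵐᵒᵖ)
    (hF : ∀ {i j}, i ≠ j → ∀ x, (F (S.e i j)).unop x = if x = j then i else x)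
    (hr : ∀ x, r (r x) = r x) (x : α) : (F (S.retractProd r hr)).unop x = r x := by
  have key : ∀ s : Finset α, (F (s.noncommProd (S.retractFactor r)
      (S.commute_retractFactor hr _))).unop x = if x ∈ s then r x else x := by
    intro s
    induction s using Finset.induction_on with
    | empty => rw [Finset.noncommProd_empty, map_one]; rfl
    | insert a s ha ih =>
      -- The factor at `a` acts last; if `r` moves `a`, then `a` is not a value of `r`, so the
      -- values already reached are undisturbed.
      rw [Finset.noncommProd_insert_of_notMem' _ _ _ _ ha, map_mul]
      change (F (S.retractFactor r a)).unop ((F (s.noncommProd _ _)).unop x) = _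
      rw [ih]
      by_cases h : r a = a
      · rw [S.retractFactor_of_fixed h, map_one]
        change (if x ∈ s then r x else x) = _
        grind
      · rw [S.retractFactor_of_ne h, hF h]
        grind
  exact (key Finset.univ).trans (if_pos (Finset.mem_univ x))

end CollapseSystem

/-! ### The collapse system generated by a single element. -/

section Collapse

open Equiv

variable {α M : Type*} [Monoid M]

/-- The points are placed one at a time, each by a transposition that leaves the earlier targets
alone. -/
lemma exists_perm_apply_eq {a b c d i j k l : α} (hab : a ≠ b) (hac : a ≠ c) (had : a ≠ d)
    (hbc : b ≠ c) (hbd : b ≠ d) (hcd : c ≠ d) (hij : i ≠ j) (hik : i ≠ k) (hil : i ≠ l)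
    (hjk : j ≠ k) (hjl : j ≠ l) (hkl : k ≠ l) :
    ∃ σ : Perm α, σ a = i ∧ σ b = j ∧ σ c = k ∧ σ d = l := by
  have step : ∀ (σ : Perm α) (x y : α), ∃ τ : Perm α, τ x = y ∧
      ∀ z, z ≠ x → σ z ≠ y → τ z = σ z := by
    classical
    exact fun σ x y =>
    ⟨swap (σ x) y * σ, by simp, fun z hz hy => by
      rw [Perm.mul_apply, swap_apply_of_ne_of_ne (σ.injective.ne hz) hy]⟩
  obtain ⟨σ₁, ha₁, -⟩ := step 1 a i
  obtain ⟨σ₂, hb₂, h₂⟩ := step σ₁ b j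
  have ha₂ := (h₂ a hab (ha₁ ▸ hij)).trans ha₁
  obtain ⟨σ₃, hc₃, h₃⟩ := step σ₂ c k
  have ha₃ := (h₃ a hac (ha₂ ▸ hik)).trans ha₂
  have hb₃ := (h₃ b hbc (hb₂ ▸ hjk)).trans hb₂
  obtain ⟨σ₄, hd₄, h₄⟩ := step σ₃ d l
  exact ⟨σ₄, (h₄ a had (ha₃ ▸ hil)).trans ha₃, (h₄ b hbd (hb₃ ▸ hjl)).trans hb₃,
    (h₄ c hcd (hc₃ ▸ hkl)).trans hc₃, hd₄⟩

open Classical in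
/-- The conjugate of `ζ` by a permutation that sends `a` to `i` and `b` to `j`. -/
noncomputable def conjCollapse (p : Perm α → M) (ζ : M) (a b i j : α) : M :=
  if h : ∃ σ : Perm α, σ a = i ∧ σ b = j then p h.choose⁻¹ * ζ * p h.choose else 1

/-- Two permutations with the same values at `a` and `b` differ by one fixing both points, which
commutes with `ζ`; so the choice does not matter. -/
lemma conjCollapse_apply {p : Perm α → M} (p_mul_p : ∀ σ τ, p σ * p τ = p (τ * σ))
    {ζ : M} {a b : α} (hstab : ∀ σ : Perm α, σ a = a → σ b = b → p σ * ζ = ζ * p σ)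
    (σ : Perm α) : conjCollapse p ζ a b (σ a) (σ b) = p σ⁻¹ * ζ * p σ := by
  have h : ∃ τ : Perm α, τ a = σ a ∧ τ b = σ b := ⟨σ, rfl, rfl⟩
  rw [conjCollapse, dif_pos h]
  obtain ⟨h1, h2⟩ := h.choose_spec
  generalize h.choose = τ at h1 h2
  have hτ : p τ = p (σ⁻¹ * τ) * p σ := by rw [p_mul_p, mul_inv_cancel_left]
  rw [hτ, mul_assoc, ← mul_assoc ζ, ← hstab _ (by simp [h1]) (by simp [h2]), ← mul_assoc,
    ← mul_assoc, p_mul_p, mul_assoc σ⁻¹, mul_inv_cancel, mul_one]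

/-- The collapse system generated by an element `ζ` that collapses `b` to `a`. -/
noncomputable def CollapseSystem.ofGenerator [DecidableEq α] (p : Perm α → M) (p_one : p 1 = 1)
    (p_mul_p : ∀ σ τ, p σ * p τ = p (τ * σ)) (ζ : M) (a b c d : α)
    (hab : a ≠ b) (hac : a ≠ c) (had : a ≠ d) (hbc : b ≠ c) (hbd : b ≠ d) (hcd : c ≠ d)
    (hfour : ∀ i j k : α, ∃ l, i ≠ l ∧ j ≠ l ∧ k ≠ l)
    (hstab : ∀ σ : Perm α, σ a = a → σ b = b → p σ * ζ = ζ * p σ)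
    (hswap : p (swap a b) * ζ = ζ)
    (hsame : ζ * p (swap a c) * ζ * p (swap a c) = ζ)
    (hcomm : p (swap b c * swap a d) * ζ * p (swap b c * swap a d) * ζ =
      ζ * p (swap b c * swap a d) * ζ * p (swap b c * swap a d))
    (htriple : p (swap b c) * ζ * p (swap b c) * ζ * p (swap b c) * ζ * p (swap b c) =
      ζ * p (swap b c) * ζ) : CollapseSystem α M :=
  have hconj := conjCollapse_apply p_mul_p hstab
  have trans₃ : ∀ {i j k}, i ≠ j → i ≠ k → j ≠ k →
      ∃ σ : Perm α, σ a = i ∧ σ b = j ∧ σ c = k := fun {i j k} hij hik hjk => by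
    obtain ⟨l, hil, hjl, hkl⟩ := hfour i j k
    obtain ⟨σ, h1, h2, h3, -⟩ :=
      exists_perm_apply_eq hab hac had hbc hbd hcd hij hik hil hjk hjl hkl
    exact ⟨σ, h1, h2, h3⟩
  have trans₂ : ∀ {i j}, i ≠ j → ∃ σ : Perm α, σ a = i ∧ σ b = j := fun {i j} hij => by
    obtain ⟨k, hik, hjk, -⟩ := hfour i j j
    obtain ⟨σ, h1, h2, -⟩ := trans₃ hij hik hjk
    exact ⟨σ, h1, h2⟩
  have base : conjCollapse p ζ a b a b = ζ := by
    simpa [p_one] using hconj 1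
  have e_mul_p : ∀ {i j} (σ : Perm α), i ≠ j → conjCollapse p ζ a b i j * p σ =
      p σ * conjCollapse p ζ a b (σ i) (σ j) := fun {i j} τ hij => by
    obtain ⟨σ, rfl, rfl⟩ := trans₂ hij
    have h := hconj (τ * σ)
    rw [Perm.mul_apply, Perm.mul_apply] at h
    rw [h, hconj, mul_assoc, p_mul_p, ← mul_assoc, ← mul_assoc, p_mul_p, mul_inv_rev,
      inv_mul_cancel_right]
  have p_mul_e : ∀ {i j} (σ : Perm α) (w : M), i ≠ j →
      p σ * (conjCollapse p ζ a b (σ i) (σ j) * w) = conjCollapse p ζ a b i j * (p σ * w) :=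
    fun σ w hij => by rw [← mul_assoc, ← e_mul_p σ hij, mul_assoc]
  have p_mul_swap : ∀ (σ : Perm α) (i j : α) (w : M),
      p σ * (p (swap (σ i) (σ j)) * w) = p (swap i j) * (p σ * w) := fun σ i j w => by
    rw [← mul_assoc, ← mul_assoc, p_mul_p, p_mul_p, mul_swap_eq_swap_mul]
  -- Each axiom is checked at the base points after multiplying by `p σ` and moving it rightwards
  -- through the word. The trailing `1` gives the last letter a tail, as `p_mul_e` and `p_mul_swap`
  -- require.
  have cancel : ∀ (σ : Perm α) {x y : M}, p σ * (x * 1) = p σ * (y * 1) → x = y :=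
    fun σ x y h => by
      have := congrArg (p σ⁻¹ * ·) h
      simpa only [← mul_assoc, p_mul_p, mul_inv_cancel, p_one, one_mul, mul_one] using this
  have hcb : conjCollapse p ζ a b c b = p (swap a c) * ζ * p (swap a c) := by
    simpa [swap_apply_of_ne_of_ne hab.symm hbc] using hconj (swap a c)
  have hacE : conjCollapse p ζ a b a c = p (swap b c) * ζ * p (swap b c) := by
    simpa [swap_apply_of_ne_of_ne hab hac] using hconj (swap b c)
  have hdc : conjCollapse p ζ a b d c =
      p (swap b c * swap a d) * ζ * p (swap b c * swap a d) := by
    have hinv : (swap b c * swap a d)⁻¹ = swap b c * swap a d := by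
      rw [mul_inv_rev, swap_inv, swap_inv]
      exact (Perm.disjoint_swap_swap (by simp [*, Ne.symm])).commute
    have := hconj (swap b c * swap a d)
    rw [hinv] at this
    simpa [swap_apply_of_ne_of_ne hbd.symm hcd.symm, swap_apply_of_ne_of_ne hab.symm hbd]
      using this
  { p := p
    e := conjCollapse p ζ a b
    p_one := p_one
    p_mul_p := p_mul_p
    e_mul_p := e_mul_p
    swap_mul_e := fun {i j} hij => by
      obtain ⟨σ, rfl, rfl⟩ := trans₂ hij
      apply cancel σ
      simp only [mul_assoc, p_mul_swap, p_mul_e σ _ hab, base]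
      rw [← mul_assoc, hswap]
    e_mul_e_of_ne := fun {i j k} hij hkj hik => by
      obtain ⟨σ, rfl, rfl, rfl⟩ := trans₃ hij hik hkj.symm
      apply cancel σ
      simp only [mul_assoc, p_mul_e σ _ hab, p_mul_e σ _ hbc.symm, base, hcb]
      simp only [← mul_assoc, hsame]
    e_comm_of_disjoint := fun {i j k l} hij hik hil hjk hjl hkl => by
      obtain ⟨σ, rfl, rfl, rfl, rfl⟩ :=
        exists_perm_apply_eq hab hac had hbc hbd hcd hij hil hik hjl hjk hkl.symm
      apply cancel σ
      simp only [mul_assoc, p_mul_e σ _ hab, p_mul_e σ _ hcd.symm, base, hdc]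
      simp only [← mul_assoc, hcomm]
    e_mul_e_mul_e := fun {i j k} hij hik hjk => by
      obtain ⟨σ, rfl, rfl, rfl⟩ := trans₃ hij hik hjk
      apply cancel σ
      simp only [mul_assoc, p_mul_swap, p_mul_e σ _ hab, p_mul_e σ _ hac, base, hacE]
      simp only [← mul_assoc, htriple]
    exists_third := fun i j => by
      obtain ⟨k, hik, hjk, -⟩ := hfour i j j
      exact ⟨k, hik.symm, hjk.symm⟩ }

/-! ### Commutation of `ζ` with the permutations fixing the two base points. -/

section Stabilizer

variable [DecidableEq α] {p : Perm α → M} (p_one : p 1 = 1)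
  (p_mul_p : ∀ σ τ, p σ * p τ = p (τ * σ)) {ζ : M}

include p_one p_mul_p

/-- By `hc`, conjugation by `p c` takes `ζ` to `p (swap a b) * ζ`, so the conjugate of `σ` commutes
with the latter. It also commutes with the invertible factor `p (swap a b)`, which can be cancelled.
That this factor fixes `ζ` is not needed. -/
lemma swap_conj_commute {a b : α} {c : Perm α} (hca : c a = a) (hcb : c b = b)
    (hc : p (swap a b * c) * ζ = ζ * p c) {σ : Perm α} (hσa : σ a = a) (hσb : σ b = b)
    (hσ : p σ * ζ = ζ * p σ) : p (c * σ * c⁻¹) * ζ = ζ * p (c * σ * c⁻¹) := by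
  have comm : ∀ {τ : Perm α}, τ a = a → τ b = b → p τ * p (swap a b) = p (swap a b) * p τ := by
    intro τ ha hb
    rw [p_mul_p, p_mul_p, mul_swap_eq_swap_mul, ha, hb]
  have hs : p (swap a b) * p (swap a b) = 1 := by rw [p_mul_p, swap_mul_self, p_one]
  have hcc : p c⁻¹ * p c = 1 := by rw [p_mul_p, mul_inv_cancel, p_one]
  have hcc' : p c * p c⁻¹ = 1 := by rw [p_mul_p, inv_mul_cancel, p_one]
  have hexp : p (c * σ * c⁻¹) = p c⁻¹ * p σ * p c := by rw [p_mul_p, p_mul_p, mul_assoc]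
  rw [← p_mul_p] at hc
  have h1 : p (swap a b) * ζ * p c⁻¹ = p c⁻¹ * ζ := by
    rw [← one_mul (p (swap a b)), ← hcc, mul_assoc (p c⁻¹), mul_assoc (p c⁻¹), hc, mul_assoc,
      mul_assoc, hcc', mul_one]
  have h2 : ζ * p c⁻¹ = p (swap a b) * (p c⁻¹ * ζ) := by
    rw [← h1, ← mul_assoc, ← mul_assoc, hs, one_mul]
  have h3 := comm (τ := c * σ * c⁻¹)
    (by simp [hσa, hca, (Equiv.symm_apply_eq c).2 hca.symm])
    (by simp [hσb, hcb, (Equiv.symm_apply_eq c).2 hcb.symm])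
  calc p (c * σ * c⁻¹) * ζ = p (c * σ * c⁻¹) * p (swap a b) * (p (swap a b) * ζ) := by
        rw [mul_assoc (p (c * σ * c⁻¹)), ← mul_assoc (p (swap a b)), hs, one_mul]
    _ = p (swap a b) * (p c⁻¹ * p σ * (p c * p (swap a b) * ζ)) := by
        rw [h3, hexp]
        simp only [mul_assoc]
    _ = p (swap a b) * (p c⁻¹ * (p σ * ζ) * p c) := by
        rw [hc]
        simp only [mul_assoc]
    _ = ζ * p (c * σ * c⁻¹) := by
        rw [hσ, ← mul_assoc, ← mul_assoc, ← mul_assoc, mul_assoc (p (swap a b)), ← h2, hexp]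
        simp only [mul_assoc]

end Stabilizer

section Fin

variable {n : ℕ} {p : Perm (Fin n) → M} (p_one : p 1 = 1)
  (p_mul_p : ∀ σ τ, p σ * p τ = p (τ * σ)) {ζ : M}

include p_one p_mul_p

/-- An element commutes with all permutations that fix the first two points as soon as it commutes
with the transpositions of the other adjacent points. -/
lemma commute_of_adjacent_swaps
    (hadj : ∀ k (hk : k + 1 < n), 2 ≤ k →
      p (swap ⟨k, by omega⟩ ⟨k + 1, hk⟩) * ζ = ζ * p (swap ⟨k, by omega⟩ ⟨k + 1, hk⟩))
    (σ : Perm (Fin n)) (hσ : ∀ x : Fin n, x.val < 2 → σ x = x) : p σ * ζ = ζ * p σ := by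
  have mul : ∀ {σ τ : Perm (Fin n)}, p σ * ζ = ζ * p σ → p τ * ζ = ζ * p τ →
      p (τ * σ) * ζ = ζ * p (τ * σ) := by
    intro σ τ h1 h2
    rw [← p_mul_p, mul_assoc, h2, ← mul_assoc, h1, mul_assoc]
  have hlt : ∀ j (hj : j < n) i (hij : i < j), 2 ≤ i →
      p (swap ⟨i, by omega⟩ ⟨j, hj⟩) * ζ = ζ * p (swap ⟨i, by omega⟩ ⟨j, hj⟩) := by
    intro j
    induction j with
    | zero => intro _ i hij; omega
    | succ j ih =>
      intro hj i hij hi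
      rcases Nat.lt_succ_iff_lt_or_eq.1 hij with h | rfl
      · have h1 := hadj j hj (by omega)
        have h2 := ih (by omega) i h hi
        have h3 : swap (⟨i, by omega⟩ : Fin n) ⟨j + 1, hj⟩ =
            swap ⟨j, by omega⟩ ⟨j + 1, hj⟩ * swap ⟨i, by omega⟩ ⟨j, by omega⟩ *
              swap ⟨j, by omega⟩ ⟨j + 1, hj⟩ := by
          rw [swap_mul_swap_mul_swap, swap_comm] <;> (rw [Ne, Fin.ext_iff]; simp only; omega)
        rw [h3]
        exact mul h1 (mul h2 h1)
      · exact hadj i hj hi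
  have hswap : ∀ x y : Fin n, 2 ≤ x.val → 2 ≤ y.val →
      p (swap x y) * ζ = ζ * p (swap x y) := by
    intro x y hx hy
    rcases lt_trichotomy x.val y.val with h | h | h
    · exact hlt y y.2 x h hx
    · rw [Fin.ext h, swap_self]
      exact p_one.symm ▸ (one_mul ζ).trans (mul_one ζ).symm
    · rw [swap_comm]
      exact hlt x x.2 y h hy
  induction hm : σ.support.card using Nat.strong_induction_on generalizing σ with
  | _ m ih =>
    by_cases h1 : σ = 1
    · rw [h1, p_one, one_mul, mul_one]
    obtain ⟨x, hx⟩ : ∃ x, σ x ≠ x := by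
      by_contra! hc
      exact h1 (Perm.ext hc)
    have hx1 : 2 ≤ x.val := not_lt.1 fun h => hx (hσ x h)
    have hx2 : 2 ≤ (σ x).val := not_lt.1 fun h => hx (σ.injective (hσ _ h))
    have h2 := ih _ (hm ▸ Perm.card_support_swap_mul hx) (swap x (σ x) * σ)
      (fun y hy => by
        rw [Perm.mul_apply, hσ y hy]
        exact swap_apply_of_ne_of_ne (by rintro rfl; omega) (by rintro rfl; omega)) rfl
    have h3 : σ = swap x (σ x) * (swap x (σ x) * σ) := by
      rw [← mul_assoc, swap_mul_self, one_mul]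
    rw [h3]
    exact mul h2 (hswap x (σ x) hx1 hx2)

/-- The relations for the transposition and the long cycle give all relations
between `ζ` and the permutations that fix the first two points. -/
lemma commute_of_fixes {a b : Fin n} (ha : a.val = 0) (hb : b.val = 1) (c : Perm (Fin n))
    (hca : c a = a) (hcb : c b = b)
    (hc : ∀ k (hk : k + 1 < n), 2 ≤ k → c ⟨k, by omega⟩ = ⟨k + 1, hk⟩)
    (hrel : p (swap a b * c) * ζ = ζ * p c)
    (hbase : ∀ h : 3 < n, p (swap ⟨2, by omega⟩ ⟨3, h⟩) * ζ = ζ * p (swap ⟨2, by omega⟩ ⟨3, h⟩))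
    (σ : Perm (Fin n)) (hσa : σ a = a) (hσb : σ b = b) : p σ * ζ = ζ * p σ := by
  refine commute_of_adjacent_swaps p_one p_mul_p ?_ σ ?_
  · intro k hk hk2
    induction k, hk2 using Nat.le_induction with
    | base => exact hbase hk
    | succ k hk2 ih =>
      -- Conjugation by `c` shifts an adjacent transposition one step up, so all of them arise from
      -- the first.
      have h : swap (⟨k + 1, by omega⟩ : Fin n) ⟨k + 1 + 1, hk⟩ =
          c * swap ⟨k, by omega⟩ ⟨k + 1, by omega⟩ * c⁻¹ := by
        rw [mul_swap_eq_swap_mul, mul_inv_cancel_right, hc k (by omega) hk2,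
          hc (k + 1) hk (by omega)]
      rw [h]
      refine swap_conj_commute p_one p_mul_p hca hcb hrel ?_ ?_ (ih (by omega))
      all_goals
        apply swap_apply_of_ne_of_ne <;> (rw [Ne, Fin.ext_iff]; simp only; omega)
  · intro x hx
    have : x = a ∨ x = b := by simp only [Fin.ext_iff]; omega
    rcases this with rfl | rfl <;> assumption

end Fin

end Collapse

/-! ### Comparison with the full transformation monoid. -/

section Main

open Equiv

/-- The inclusion of `S_n` in `T_n` as a homomorphism. -/
def permToTransHom (n : ℕ) : SymGroup n →* TransMonoid n where
  toFun := permToTrans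
  map_one' := rfl
  map_mul' _ _ := rfl

/-- The permutation `(3, 4, …, n)` in function form. -/
abbrev longPerm (n : ℕ) : Perm (Fin n) := ((List.finRange n).drop 2).formPerm

lemma longPerm_apply_of_lt {n : ℕ} (x : Fin n) (hx : x.val < 2) : longPerm n x = x := by
  apply List.formPerm_apply_of_notMem
  intro h
  obtain ⟨k, hk, h⟩ := List.getElem_of_mem h
  rw [List.getElem_drop, List.getElem_finRange, Fin.ext_iff] at h
  simp at h
  omega

lemma longPerm_apply_succ {n : ℕ} (k : ℕ) (hk : k + 1 < n) (hk2 : 2 ≤ k) :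
    longPerm n ⟨k, by omega⟩ = ⟨k + 1, hk⟩ := by
  obtain ⟨k, rfl⟩ := Nat.exists_eq_add_of_le hk2
  have h := List.formPerm_apply_lt_getElem ((List.finRange n).drop 2)
    ((List.nodup_finRange n).sublist (List.drop_sublist _ _)) k (by simp; omega)
  simpa [List.getElem_drop, List.getElem_finRange, add_assoc] using h

/-- A homomorphism from a monoid generated by a collapse system to the full transformation
monoid is bijective if it sends each `p σ` to `σ` and each `e i j` to the map that sends `j` to
`i` and fixes all other points. -/
lemma CollapseSystem.bijective_of_generate {α M : Type*} [DecidableEq α] [Fintype α] [Monoid M]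
    (S : CollapseSystem α M) (F : M →* (Function.End α)ᵐᵒᵖ)
    (hFp : ∀ (σ : Perm α) x, (F (S.p σ)).unop x = σ x)
    (hFe : ∀ {i j}, i ≠ j → ∀ x, (F (S.e i j)).unop x = if x = j then i else x)
    (hgen : Submonoid.closure {w | (∃ σ, w = S.p σ) ∨ ∃ i j, i ≠ j ∧ w = S.e i j} = ⊤) :
    Function.Bijective F := by
  have hF : ∀ {r : α → α} (hr : ∀ x, r (r x) = r x) (σ : Perm α) x,
      (F (S.retractProd r hr * S.p σ)).unop x = σ (r x) := by
    intro r hr σ x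
    rw [map_mul]
    change (F (S.p σ)).unop ((F (S.retractProd r hr)).unop x) = _
    rw [S.map_retractProd F hFe hr, hFp]
  have normal : ∀ w : M, ∃ (r : α → α) (hr : ∀ x, r (r x) = r x) (σ : Perm α),
      w = S.retractProd r hr * S.p σ := by
    intro w
    have hw : w ∈ Submonoid.closure {w | (∃ σ, w = S.p σ) ∨ ∃ i j, i ≠ j ∧ w = S.e i j} :=
      hgen ▸ Submonoid.mem_top w
    induction hw using Submonoid.closure_induction_right with
    | one => exact ⟨id, fun _ => rfl, 1, by rw [S.retractProd_id, S.p_one, one_mul]⟩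
    | mul_right x _ y hy ih =>
      obtain ⟨r, hr, σ, rfl⟩ := ih
      rcases hy with ⟨τ, rfl⟩ | ⟨i, j, hij, rfl⟩
      · exact ⟨r, hr, τ * σ, by rw [mul_assoc, S.p_mul_p]⟩
      · exact S.exists_retractProd_mul_e hij hr σ
  constructor
  · intro w w' h
    obtain ⟨r, hr, σ, rfl⟩ := normal w
    obtain ⟨r', hr', σ', rfl⟩ := normal w'
    refine S.retractProd_mul_p_congr hr hr' fun x => ?_
    rw [← hF hr, ← hF hr', h]
  · intro f
    let g : α → α := f.unop
    let s : Set.range g → α := fun y => y.2.choose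
    -- `s` is a section of `g` over its image, so `s ∘ g` is a retraction; extending `s y ↦ y` to a
    -- permutation `σ` of the finite set gives `g` as `s ∘ g` followed by `σ`.
    have hs : ∀ y, g (s y) = y := fun y => y.2.choose_spec
    have hsinj : Function.Injective s := fun y y' h =>
      Subtype.ext (by rw [← hs, ← hs, h])
    obtain ⟨σ, hσ⟩ := Perm.exists_extending_pair s Subtype.val hsinj Subtype.val_injective
    have hr : ∀ x, s ⟨g (s ⟨g x, x, rfl⟩), _, rfl⟩ = s ⟨g x, x, rfl⟩ := fun x =>
      congrArg s (Subtype.ext (hs _))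
    refine ⟨S.retractProd (fun x => s ⟨g x, x, rfl⟩) hr * S.p σ, ?_⟩
    apply MulOpposite.unop_injective
    funext x
    rw [hF hr, hσ]

lemma unop_mul_apply {α : Type*} (f g : (Function.End α)ᵐᵒᵖ) (x : α) :
    (f * g).unop x = g.unop (f.unop x) := rfl

lemma unop_permToTrans_apply {n : ℕ} (σ : SymGroup n) (x : Fin n) :
    (permToTrans σ).unop x = σ.unop x := rfl

lemma unop_idem_apply {n : ℕ} (hn : 5 ≤ n) (h1 : 1 ≤ 1 ∧ 1 ≤ n) (h2 : 1 ≤ 2 ∧ 2 ≤ n)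
    (x : Fin n) : (idem n hn).unop x = if x = pt 2 h2 then pt 1 h1 else x := rfl

lemma unop_transp {n i j : ℕ} (hi : 1 ≤ i ∧ i ≤ n) (hj : 1 ≤ j ∧ j ≤ n) :
    (transp i j hi hj).unop = swap (pt i hi) (pt j hj) := rfl

lemma unop_longCycle (n : ℕ) : (longCycle n).unop = longPerm n := rfl

lemma pt_ne_pt {n i j : ℕ} (hi : 1 ≤ i ∧ i ≤ n) (hj : 1 ≤ j ∧ j ≤ n) (h : i ≠ j) :
    pt i hi ≠ pt j hj := by
  rw [Ne, Fin.ext_iff]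
  simp only [pt]
  omega

section Generators

variable {n : ℕ} {A : Type*} {R : FreeMonoid A → FreeMonoid A → Prop}
  {p q : Fin 2 → FreeMonoid A} {r : Fin 4 → FreeMonoid A} {s : Fin 5 → FreeMonoid A}
  {t u : FreeMonoid A}

variable (R p q r s t u) in
/-- The homomorphism from the presented monoid over `A` to the one over `A ∪ {ζ}`. -/
def baseHom : PresentedMonoid R →* PresentedMonoid (TransRels R p q r s t u) :=
  PresentedMonoid.lift (fun a => PresentedMonoid.of _ (some a)) fun v w h => by
    have key : FreeMonoid.lift (fun a => PresentedMonoid.of (TransRels R p q r s t u) (some a)) =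
        (PresentedMonoid.mk (TransRels R p q r s t u)).comp liftWord :=
      FreeMonoid.hom_eq fun a => rfl
    rw [key]
    exact PresentedMonoid.mk_eq_mk_of_rel (TransRels.ofBase h)

/-- This makes the choice of words for the permutations immaterial. -/
lemma mk_liftWord (w : FreeMonoid A) :
    PresentedMonoid.mk (TransRels R p q r s t u) (liftWord w) =
      baseHom R p q r s t u (PresentedMonoid.mk R w) := by
  have key : (PresentedMonoid.mk (TransRels R p q r s t u)).comp liftWord =
      (baseHom R p q r s t u).comp (PresentedMonoid.mk R) := FreeMonoid.hom_eq fun a => rfl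
  exact DFunLike.congr_fun key w

/-- The values in `T_n` of the generators in `A ∪ {ζ}`. -/
def genValue (hn : 5 ≤ n) (e : PresentedMonoid R ≃* SymGroup n) : Option A → TransMonoid n
  | some a => permToTrans (e (PresentedMonoid.of R a))
  | none => idem n hn

lemma lift_genValue_liftWord (hn : 5 ≤ n) (e : PresentedMonoid R ≃* SymGroup n)
    (w : FreeMonoid A) :
    FreeMonoid.lift (genValue hn e) (liftWord w) = permToTrans (e (PresentedMonoid.mk R w)) := by
  have key : (FreeMonoid.lift (genValue hn e)).comp liftWord =
      ((permToTransHom n).comp e.toMonoidHom).comp (PresentedMonoid.mk R) :=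
    FreeMonoid.hom_eq fun a => rfl
  exact DFunLike.congr_fun key w

lemma lift_genValue_zeta (hn : 5 ≤ n) (e : PresentedMonoid R ≃* SymGroup n) :
    FreeMonoid.lift (genValue hn e) zeta = idem n hn := rfl

lemma lift_genValue_eq (hn : 5 ≤ n) (e : PresentedMonoid R ≃* SymGroup n)
    (h1 : 1 ≤ 1 ∧ 1 ≤ n) (h2 : 1 ≤ 2 ∧ 2 ≤ n) (h3 : 1 ≤ 3 ∧ 3 ≤ n) (h4 : 1 ≤ 4 ∧ 4 ≤ n)
    (h5 : 1 ≤ n ∧ n ≤ n)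
    (hp : ∀ i, e (PresentedMonoid.mk R (p i)) = transp 1 3 h1 h3)
    (hq : ∀ i, e (PresentedMonoid.mk R (q i)) = transp 3 4 h3 h4)
    (hr : ∀ i, e (PresentedMonoid.mk R (r i)) =
      transp 1 n h1 h5 * transp 2 3 h2 h3)
    (hs : ∀ i, e (PresentedMonoid.mk R (s i)) = transp 2 3 h2 h3)
    (ht : e (PresentedMonoid.mk R t) = longCycle n * transp 1 2 h1 h2)
    (hu : e (PresentedMonoid.mk R u) = longCycle n) (v w : FreeMonoid (Option A))
    (h : TransRels R p q r s t u v w) :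
    FreeMonoid.lift (genValue hn e) v = FreeMonoid.lift (genValue hn e) w := by
  have h12 := pt_ne_pt h1 h2 (by omega)
  have h13 := pt_ne_pt h1 h3 (by omega)
  have h14 := pt_ne_pt h1 h4 (by omega)
  have h1n := pt_ne_pt h1 h5 (by omega)
  have h23 := pt_ne_pt h2 h3 (by omega)
  have h24 := pt_ne_pt h2 h4 (by omega)
  have h2n := pt_ne_pt h2 h5 (by omega)
  have h34 := pt_ne_pt h3 h4 (by omega)
  have h3n := pt_ne_pt h3 h5 (by omega)
  cases h with
  | ofBase h =>
    rw [lift_genValue_liftWord, lift_genValue_liftWord, PresentedMonoid.mk_eq_mk_of_rel h]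
  | rel1 =>
    apply MulOpposite.unop_injective
    funext x
    simp only [map_mul, lift_genValue_liftWord, lift_genValue_zeta, hp, unop_mul_apply,
      unop_permToTrans_apply, unop_idem_apply hn h1 h2, unop_transp,
      swap_apply_def]
    grind
  | rel3 =>
    apply MulOpposite.unop_injective
    funext x
    simp only [map_mul, lift_genValue_liftWord, lift_genValue_zeta, hq, unop_mul_apply,
      unop_permToTrans_apply, unop_idem_apply hn h1 h2, unop_transp,
      swap_apply_def]
    grind
  | rel7 =>
    apply MulOpposite.unop_injective
    funext x
    simp only [map_mul, lift_genValue_liftWord, lift_genValue_zeta, hr, unop_mul_apply,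
      unop_permToTrans_apply, unop_idem_apply hn h1 h2, unop_transp, MulOpposite.unop_mul,
      Perm.mul_apply, swap_apply_def]
    grind
  | rel8 =>
    apply MulOpposite.unop_injective
    funext x
    simp only [map_mul, lift_genValue_liftWord, lift_genValue_zeta, hs, unop_mul_apply,
      unop_permToTrans_apply, unop_idem_apply hn h1 h2, unop_transp,
      swap_apply_def]
    grind
  | rel9 =>
    apply MulOpposite.unop_injective
    funext x
    simp only [map_mul, lift_genValue_liftWord, lift_genValue_zeta, ht, hu, unop_mul_apply,
      unop_permToTrans_apply, unop_idem_apply hn h1 h2, unop_transp, MulOpposite.unop_mul,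
      Perm.mul_apply, unop_longCycle]
    have hl1 := longPerm_apply_of_lt (pt 1 h1 : Fin n) (by simp [pt])
    have hl2 := longPerm_apply_of_lt (pt 2 h2 : Fin n) (by simp [pt])
    by_cases hx1 : x = pt 1 h1
    · rw [hx1, hl1, if_neg h12, swap_apply_left, if_pos rfl, hl1]
    by_cases hx2 : x = pt 2 h2
    · rw [hx2, hl2, if_pos rfl, swap_apply_right, if_neg h12, hl1]
    -- The long cycle fixes 1 and 2, hence preserves the set of other points, where both the
    -- transposition and `ζ` act trivially.
    have hy1 : longPerm n x ≠ pt 1 h1 := fun h =>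
      hx1 ((longPerm n).injective (h.trans hl1.symm))
    have hy2 : longPerm n x ≠ pt 2 h2 := fun h =>
      hx2 ((longPerm n).injective (h.trans hl2.symm))
    rw [swap_apply_of_ne_of_ne hy1 hy2, if_neg hy2, if_neg hx2]

end Generators

theorem theorem5 (n : ℕ) (hn : 5 ≤ n) {A : Type*}
    (R : FreeMonoid A → FreeMonoid A → Prop)
    -- `⟨A | R⟩` is a monoid presentation for `S_n`
    (e : PresentedMonoid R ≃* SymGroup n)
    -- arbitrary words over `A` representing the permutations that occur in the relations
    (p q : Fin 2 → FreeMonoid A) (r : Fin 4 → FreeMonoid A) (s : Fin 5 → FreeMonoid A)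
    (t u : FreeMonoid A)
    (hp : ∀ i, e (PresentedMonoid.mk R (p i)) = transp 1 3 (by omega) (by omega))
    (hq : ∀ i, e (PresentedMonoid.mk R (q i)) = transp 3 4 (by omega) (by omega))
    (hr : ∀ i, e (PresentedMonoid.mk R (r i)) =
      transp 1 n (by omega) (by omega) * transp 2 3 (by omega) (by omega))
    (hs : ∀ i, e (PresentedMonoid.mk R (s i)) = transp 2 3 (by omega) (by omega))
    (ht : e (PresentedMonoid.mk R t) = longCycle n * transp 1 2 (by omega) (by omega))
    (hu : e (PresentedMonoid.mk R u) = longCycle n) :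
    ∃ E : PresentedMonoid (TransRels R p q r s t u) ≃* TransMonoid n,
      (∀ a : A, E (PresentedMonoid.of (TransRels R p q r s t u) (some a)) =
        permToTrans (e (PresentedMonoid.of R a))) ∧
      E (PresentedMonoid.of (TransRels R p q r s t u) none) = idem n hn := by
  let F : PresentedMonoid (TransRels R p q r s t u) →* TransMonoid n :=
    PresentedMonoid.lift (genValue hn e) (lift_genValue_eq hn e (by omega) (by omega)
      (by omega) (by omega) (by omega) hp hq hr hs ht hu)
  let P : Perm (Fin n) → PresentedMonoid (TransRels R p q r s t u) := fun σ =>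
    baseHom R p q r s t u (e.symm (MulOpposite.op σ))
  have P_one : P 1 = 1 := by
    change baseHom R p q r s t u (e.symm 1) = 1
    rw [map_one, map_one]
  have P_mul : ∀ σ τ, P σ * P τ = P (τ * σ) := fun σ τ => by
    rw [← map_mul, ← map_mul, ← MulOpposite.op_mul]
  have mk_word : ∀ {w : FreeMonoid A} {σ : Perm (Fin n)},
      e (PresentedMonoid.mk R w) = MulOpposite.op σ →
      PresentedMonoid.mk (TransRels R p q r s t u) (liftWord w) = P σ := fun {w σ} h => by
    rw [mk_liftWord]
    exact congrArg _ ((e.symm_apply_eq).2 h.symm).symm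
  let ζ : PresentedMonoid (TransRels R p q r s t u) := PresentedMonoid.mk _ zeta
  have hFP : ∀ (σ : Perm (Fin n)) x, (F (P σ)).unop x = σ x := fun σ x => by
    have key : F.comp (baseHom R p q r s t u) = (permToTransHom n).comp e.toMonoidHom :=
      PresentedMonoid.ext _ fun _ => rfl
    have h := DFunLike.congr_fun key (e.symm (MulOpposite.op σ))
    change F (P σ) = permToTrans (e (e.symm (MulOpposite.op σ))) at h
    rw [h, e.apply_symm_apply]
    rfl
  have hFζ : ∀ x, (F ζ).unop x = if x = pt 2 (by omega) then pt 1 (by omega) else x :=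
    fun _ => rfl
  let a : Fin n := pt 1 (by omega)
  let b : Fin n := pt 2 (by omega)
  let c : Fin n := pt 3 (by omega)
  let d : Fin n := pt n (by omega)
  have rel1 := PresentedMonoid.mk_eq_mk_of_rel
    (TransRels.rel1 (R := R) (p := p) (q := q) (r := r) (s := s) (t := t) (u := u))
  have rel3 := PresentedMonoid.mk_eq_mk_of_rel
    (TransRels.rel3 (R := R) (p := p) (q := q) (r := r) (s := s) (t := t) (u := u))
  have rel7 := PresentedMonoid.mk_eq_mk_of_rel
    (TransRels.rel7 (R := R) (p := p) (q := q) (r := r) (s := s) (t := t) (u := u))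
  have rel8 := PresentedMonoid.mk_eq_mk_of_rel
    (TransRels.rel8 (R := R) (p := p) (q := q) (r := r) (s := s) (t := t) (u := u))
  have rel9 := PresentedMonoid.mk_eq_mk_of_rel
    (TransRels.rel9 (R := R) (p := p) (q := q) (r := r) (s := s) (t := t) (u := u))
  simp only [map_mul, fun i => mk_word (hp i)] at rel1
  simp only [map_mul, fun i => mk_word (hq i)] at rel3
  simp only [map_mul, fun i => mk_word (hr i)] at rel7
  simp only [map_mul, fun i => mk_word (hs i)] at rel8
  simp only [map_mul, mk_word ht, mk_word hu] at rel9
  have hca : longPerm n a = a := longPerm_apply_of_lt _ (by simp [a, pt])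
  have hcb : longPerm n b = b := longPerm_apply_of_lt _ (by simp [b, pt])
  have hstab : ∀ σ : Perm (Fin n), σ a = a → σ b = b → P σ * ζ = ζ * P σ :=
    commute_of_fixes P_one P_mul rfl rfl (longPerm n) hca hcb
      (fun k hk hk2 => longPerm_apply_succ k hk hk2) rel9 (fun _ => rel3)
  have hswap : P (swap a b) * ζ = ζ := by
    -- The long cycle fixes `a` and `b`, so it now commutes with `ζ` and can be cancelled from the
    -- last relation.
    have h : P (longPerm n) * (P (swap a b) * ζ) = P (longPerm n) * ζ := by
      rw [← mul_assoc, P_mul, hstab _ hca hcb]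
      exact rel9
    have h' := congrArg (P (longPerm n)⁻¹ * ·) h
    simpa only [← mul_assoc, P_mul, mul_inv_cancel, mul_inv_cancel_right, P_one, one_mul] using h'
  have hfour : ∀ i j k : Fin n, ∃ l, i ≠ l ∧ j ≠ l ∧ k ≠ l := fun i j k => by
    obtain ⟨l, -, hl⟩ := Finset.exists_mem_notMem_of_card_lt_card
      (s := {i, j, k}) (t := (Finset.univ : Finset (Fin n)))
      (Finset.card_le_three.trans_lt (by rw [Finset.card_univ, Fintype.card_fin]; omega))
    simp only [Finset.mem_insert, Finset.mem_singleton, not_or] at hl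
    exact ⟨l, Ne.symm hl.1, Ne.symm hl.2.1, Ne.symm hl.2.2⟩
  have hab : a ≠ b := pt_ne_pt _ _ (by omega)
  let S : CollapseSystem (Fin n) (PresentedMonoid (TransRels R p q r s t u)) :=
    CollapseSystem.ofGenerator P P_one P_mul ζ a b c d hab (pt_ne_pt _ _ (by omega))
      (pt_ne_pt _ _ (by omega)) (pt_ne_pt _ _ (by omega)) (pt_ne_pt _ _ (by omega))
      (pt_ne_pt _ _ (by omega)) hfour hstab hswap rel1 rel7 rel8
  have hSe : ∀ σ : Perm (Fin n), S.e (σ a) (σ b) = P σ⁻¹ * ζ * P σ :=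
    conjCollapse_apply P_mul hstab
  have hbij : Function.Bijective F := by
    refine S.bijective_of_generate F hFP ?_ ?_
    · intro i j hij x
      obtain ⟨σ, hσ⟩ := Perm.exists_extending_pair ![a, b] ![i, j]
        (by simpa [Function.Injective, Fin.forall_fin_two] using ⟨hab, hab.symm⟩)
        (by simpa [Function.Injective, Fin.forall_fin_two] using ⟨hij, hij.symm⟩)
      obtain rfl : σ a = i := hσ 0
      obtain rfl : σ b = j := hσ 1
      rw [hSe, map_mul, map_mul, unop_mul_apply, unop_mul_apply, hFP, hFP, hFζ, apply_ite σ]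
      simp [a, b, Equiv.symm_apply_eq]
    · rw [eq_top_iff, ← PresentedMonoid.closure_range_of, Submonoid.closure_le]
      rintro _ ⟨_ | x, rfl⟩
      · refine Submonoid.subset_closure (Or.inr ⟨a, b, hab, ?_⟩)
        have h := hSe 1
        rw [inv_one, P_one, one_mul, mul_one] at h
        exact h.symm
      · refine Submonoid.subset_closure (Or.inl ⟨(e (PresentedMonoid.of R x)).unop, ?_⟩)
        exact (congrArg (baseHom R p q r s t u)
          (e.symm_apply_apply (PresentedMonoid.of R x))).symm
  exact ⟨MulEquiv.ofBijective F hbij, fun a => rfl, rfl⟩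

end Main
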